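/- Let $n\ge 1$ and let $\mathbb G^n\times\mathbb R$ be $\mathbb R^{n+1}=\mathbb R^n\times\mathbb R$ with its Euclidean metric and the density $$e^{-f(\mathbf x,x_{n+1})}=(2\pi)^{-n/2}e^{-|\mathbf x|^2/2},\qquad \mathbf x\in\mathbb R^n,\ x_{n+1}\in\mathbb R .$$ A $C^2$ immersed hypersurface is called weighted minimal if $H_f=H+\langle\nabla f,\mathbf n\rangle=0$ everywhere, where $\mathbf n$ is a unit normal and $H$ is the Euclidean mean curvature with respect to $\mathbf n$ (the sum of the principal curvatures, i.e. the trace of the second fundamental form $\langle \mathrm{II},\mathbf n\rangle$). For a subset $S$ of a hypersurface put $\mathrm{Vol}_f(S)=\int_S e^{-f}\,d\mathcal H^n$, with $\mathcal H^n$ the $n$-dimensional Hausdorff measure, and for $A\subset\mathbb R^n$ put $\mathrm{Vol}_f(A)=\int_A(2\pi)^{-n/2}e^{-|\mathbf x|^2/2}\,d\mathbf x$. Let $u:\mathbb R^n\to\mathbb R$ be a $C^2$ function whose entire graph $\Sigma=\{(\mathbf x,u(\mathbf x)):\mathbf x\in\mathbb R^n\}$ is weighted minimal, and let $p=(0,u(0))$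 be the point where $\Sigma$ meets the $x_{n+1}$-axis. Then for every $R>0$, $$\mathrm{Vol}_f\bigl(\Sigma\cap B^{n+1}(p,R)\bigr)\le \mathrm{Vol}_f\bigl(B^n(O,R)\bigr)+n\,e^{-R^2}\,C_n\,R^{n-1},$$ where $B^{n+1}(p,R)$ and $B^n(O,R)$ are the open Euclidean balls in $\mathbb R^{n+1}$ and $\mathbb R^n$, and $C_n$ is the Lebesgue volume of the unit ball of $\mathbb R^n$. -/

import Mathlib

open MeasureTheory Metric
open scoped ENNReal InnerProductSpace

noncomputable section

namespace GaussProduct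

/-- Euclidean space `ℝⁿ`, the underlying Riemannian manifold of Gauss space `𝔾ⁿ`. -/
abbrev Base (n : ℕ) : Type := EuclideanSpace ℝ (Fin n)

/-- `ℝⁿ⁺¹ = ℝⁿ × ℝ` with the Euclidean metric, the underlying Riemannian manifold of `𝔾ⁿ × ℝ`.
The last coordinate is the one of the factor `ℝ`. -/
abbrev Ambient (n : ℕ) : Type := EuclideanSpace ℝ (Fin (n + 1))

/-- The projection `(x, x_{n+1}) ↦ x` of `𝔾ⁿ × ℝ` onto `𝔾ⁿ`. -/
def proj {n : ℕ} (z : Ambient n) : Base n := WithLp.toLp 2 fun i => z i.castSucc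

/-- The point `(x, t)` of `𝔾ⁿ × ℝ`. -/
def pt {n : ℕ} (x : Base n) (t : ℝ) : Ambient n :=
  WithLp.toLp 2 (Fin.snoc (α := fun _ => ℝ) (fun i => x i) t)

/-- The function `f₀` on `ℝⁿ` with `exp (-f₀ x) = (2π)^(-n/2) exp (-|x|²/2)`. -/
def gaussPotential {n : ℕ} (x : Base n) : ℝ :=
  ‖x‖ ^ 2 / 2 + (n : ℝ) / 2 * Real.log (2 * Real.pi)

theorem exp_neg_gaussPotential {n : ℕ} (x : Base n) :
    Real.exp (-gaussPotential x)
      = (2 * Real.pi) ^ (-((n : ℝ) / 2)) * Real.exp (-(‖x‖ ^ 2 / 2)) := by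
  rw [Real.rpow_def_of_pos (by positivity), ← Real.exp_add, gaussPotential]
  congr 1
  ring

/-- The function `f` on `𝔾ⁿ × ℝ`, for which `exp (-f)` is the Gaussian-Euclidean density;
it does not depend on the last coordinate. -/
def potential {n : ℕ} (z : Ambient n) : ℝ := gaussPotential (proj z)

/-- Weighted `n`-dimensional volume of a subset of Gauss space `𝔾ⁿ`. -/
def gaussVol {n : ℕ} (A : Set (Base n)) : ℝ≥0∞ :=
  ∫⁻ x in A, ENNReal.ofReal (Real.exp (-gaussPotential x)) ∂volume

/-- Weighted `n`-dimensional area of a subset of `𝔾ⁿ × ℝ`: the integral of the density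
`exp (-f)` against the `n`-dimensional Hausdorff measure, normalised to agree with
Lebesgue measure on `ℝⁿ`. -/
def weightedArea {n : ℕ} (S : Set (Ambient n)) : ℝ≥0∞ :=
  ∫⁻ z in S, ENNReal.ofReal (Real.exp (-potential z)) ∂(Measure.euclideanHausdorffMeasure n)

/-- First fundamental form `g_ij = ⟨∂_i X, ∂_j X⟩` of a parametrised hypersurface `X`. -/
def firstForm {n : ℕ} (X : Base n → Ambient n) (x : Base n) : Matrix (Fin n) (Fin n) ℝ :=
  Matrix.of fun i j =>
    ⟪fderiv ℝ X x (EuclideanSpace.single i 1), fderiv ℝ X x (EuclideanSpace.single j 1)⟫_ℝ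

/-- Second fundamental form `h_ij = ⟨∂_i ∂_j X, ν⟩` with respect to the unit normal `ν`. -/
def secondForm {n : ℕ} (X : Base n → Ambient n) (x : Base n) (ν : Ambient n) :
    Matrix (Fin n) (Fin n) ℝ :=
  Matrix.of fun i j =>
    ⟪fderiv ℝ (fderiv ℝ X) x (EuclideanSpace.single i 1) (EuclideanSpace.single j 1), ν⟫_ℝ

/-- Euclidean mean curvature (sum of the principal curvatures) `H = ∑ g^ij h_ij` at `X x`,
with respect to the unit normal `ν`. -/
def meanCurvature {n : ℕ} (X : Base n → Ambient n) (x : Base n) (ν : Ambient n) : ℝ :=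
  ((firstForm X x)⁻¹ * secondForm X x ν).trace

/-- Weighted mean curvature `H_f = H + ⟨∇f, ν⟩`. -/
def weightedMeanCurvature {n : ℕ} (X : Base n → Ambient n) (x : Base n) (ν : Ambient n) : ℝ :=
  meanCurvature X x ν + ⟪gradient potential (X x), ν⟫_ℝ

/-- `ν` is a unit normal vector of the parametrised hypersurface `X` at `X x`. -/
def IsUnitNormal {n : ℕ} (X : Base n → Ambient n) (x : Base n) (ν : Ambient n) : Prop :=
  ‖ν‖ = 1 ∧ ∀ v : Base n, ⟪fderiv ℝ X x v, ν⟫_ℝ = 0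

/-- The hypersurface parametrised by `X` is a `C²` immersion with `H_f = 0`. Both choices of the
unit normal are allowed at each point; they give opposite values of `H_f`. -/
structure IsWeightedMinimal {n : ℕ} (X : Base n → Ambient n) : Prop where
  contDiff : ContDiff ℝ 2 X
  immersion : ∀ x, Function.Injective (fderiv ℝ X x)
  weightedMeanCurvature_eq_zero :
    ∀ x ν, IsUnitNormal X x ν → weightedMeanCurvature X x ν = 0

/-- The parametrisation `x ↦ (x, u x)` of the graph of `u`. -/
def graphMap {n : ℕ} (u : Base n → ℝ) (x : Base n) : Ambient n := pt x (u x)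

/-- The entire graph `Σ = {(x, u x)}` of `u`. -/
def graph {n : ℕ} (u : Base n → ℝ) : Set (Ambient n) := Set.range (graphMap u)

end GaussProduct

end

/-!
An entire weighted minimal graph in `𝔾ⁿ × ℝ` is a horizontal hyperplane, so the weighted area of
its intersection with a ball centred on the axis equals the Gaussian volume of the ball
(`weightedArea_graph_const_inter_ball`), and the bound holds without its last term.

Write `W = √(1 + |∇u|²)`. In coordinates the condition `H_f = 0` reads
`Δu - W⁻² D²u(∇u, ∇u) - ⟨x, ∇u⟩ = 0` (`IsWeightedMinimal.graph_equation`), which says that the field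
`e^{-|x|²/2} ∇u / W` is divergence free. After multiplication by `arctan u` its divergence becomes
`e^{-|x|²/2} |∇u|² / ((1 + u²) W) ≥ 0` (`fderiv_testField_single`). The components of the product
are at most `(π / 2) e^{-|x|²/2}`, whatever the growth of `u`, because `|∇u| ≤ W`. Since Gauss space
has finite volume, testing with cutoffs of gradient `O (1 / r)` shows that a field so dominated and
with nonnegative divergence has divergence zero
(`sum_fderiv_eq_zero_of_nonneg_of_integrable_bound`). Hence `∇u = 0`.
-/

noncomputable section

namespace GaussProduct

/-! ### Coordinates on the product -/

@[simp] theorem pt_castSucc {n : ℕ} (x : Base n) (t : ℝ) (i : Fin n) :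
    pt x t i.castSucc = x i := by
  simp [pt]

@[simp] theorem pt_last {n : ℕ} (x : Base n) (t : ℝ) : pt x t (Fin.last n) = t := by
  simp [pt]

@[simp] theorem proj_pt {n : ℕ} (x : Base n) (t : ℝ) : proj (pt x t) = x := by
  ext i; simp [proj]

theorem inner_pt_pt {n : ℕ} (x y : Base n) (s t : ℝ) :
    ⟪pt x s, pt y t⟫_ℝ = ⟪x, y⟫_ℝ + s * t := by
  simp [PiLp.inner_apply, Fin.sum_univ_castSucc, mul_comm]

theorem isometry_pt {n : ℕ} (t : ℝ) : Isometry fun x : Base n => pt x t := by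
  refine Isometry.of_dist_eq fun x y => ?_
  simp [EuclideanSpace.dist_eq, Fin.sum_univ_castSucc]

/-- `(x, t) ↦ (x, t)` from the product to `ℝⁿ⁺¹`, as a continuous linear map. -/
def ptL (n : ℕ) : Base n × ℝ →L[ℝ] Ambient n :=
  LinearMap.toContinuousLinearMap
    { toFun := fun z => pt z.1 z.2
      map_add' := fun y z => by
        ext i; refine Fin.lastCases ?_ (fun i => ?_) i <;> simp
      map_smul' := fun c z => by
        ext i; refine Fin.lastCases ?_ (fun i => ?_) i <;> simp }

@[simp] theorem ptL_apply {n : ℕ} (z : Base n × ℝ) : ptL n z = pt z.1 z.2 := rfl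

/-- `proj` as a continuous linear map. -/
def projL (n : ℕ) : Ambient n →L[ℝ] Base n :=
  LinearMap.toContinuousLinearMap
    { toFun := proj
      map_add' := fun y z => by ext i; simp [proj]
      map_smul' := fun c z => by ext i; simp [proj] }

@[simp] theorem projL_apply {n : ℕ} (z : Ambient n) : projL n z = proj z := rfl

/-! ### Horizontal graphs -/

/-- The part of the horizontal hyperplane at height `t` over a ball centred at the origin, as an
isometric copy of the ball, has the weighted volume of the ball. -/
theorem weightedArea_graph_const_inter_ball {n : ℕ} (t R : ℝ) :
    weightedArea (graph (fun _ : Base n => t) ∩ ball (pt 0 t) R)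
      = gaussVol (ball (0 : Base n) R) := by
  have hiso := isometry_pt (n := n) t
  have hemb : MeasurableEmbedding fun x : Base n => pt x t :=
    hiso.isClosedEmbedding.measurableEmbedding
  have hgraph : graph (fun _ : Base n => t) = Set.range fun x : Base n => pt x t := rfl
  have hpre : (fun x : Base n => pt x t) ⁻¹' ball (pt 0 t) R = ball 0 R :=
    hiso.preimage_ball 0 R
  rw [weightedArea, gaussVol, hgraph, Set.inter_comm,
    ← Measure.restrict_restrict measurableSet_ball, ← hiso.map_euclideanHausdorffMeasure,
    EuclideanSpace.euclideanHausdorffMeasure_eq_volume, hemb.restrict_map, hemb.lintegral_map,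
    hpre]
  simp [potential]

end GaussProduct

end

/-! ### Integrable vector fields with nonnegative divergence -/

/-- A `C¹` vector field on `ℝⁿ` dominated by an integrable function and with nonnegative divergence
is divergence free: pairing the divergence with the cutoff `φ (x / r)` costs only `O (1 / r)`. -/
theorem sum_fderiv_eq_zero_of_nonneg_of_integrable_bound {n : ℕ}
    {G : Fin n → EuclideanSpace ℝ (Fin n) → ℝ} {B : EuclideanSpace ℝ (Fin n) → ℝ}
    (hG : ∀ i, ContDiff ℝ 1 (G i)) (hB : Integrable B) (hGB : ∀ i x, |G i x| ≤ B x)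
    (hdiv : ∀ x, 0 ≤ ∑ i, fderiv ℝ (G i) x (EuclideanSpace.single i 1)) (x₀ : EuclideanSpace ℝ (Fin n)) :
    ∑ i, fderiv ℝ (G i) x₀ (EuclideanSpace.single i 1) = 0 := by
  let D : EuclideanSpace ℝ (Fin n) → ℝ := fun x => ∑ i, fderiv ℝ (G i) x (EuclideanSpace.single i 1)
  have hDi : ∀ i, Continuous fun x => fderiv ℝ (G i) x (EuclideanSpace.single i 1) := fun i =>
    ((hG i).continuous_fderiv (by simp)).clm_apply continuous_const
  have hD : Continuous D := continuous_finsetSum _ fun i _ => hDi i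
  let b : ContDiffBump (0 : EuclideanSpace ℝ (Fin n)) := ⟨1, 2, one_pos, one_lt_two⟩
  have hbC : ContDiff ℝ 1 b := b.contDiff
  obtain ⟨C, hC⟩ := (b.hasCompactSupport.fderiv (𝕜 := ℝ)).exists_bound_of_continuous
    (hbC.continuous_fderiv (by simp))
  have hC0 : 0 ≤ C := (norm_nonneg _).trans (hC 0)
  let φ : ℝ → EuclideanSpace ℝ (Fin n) → ℝ := fun r x => b (r⁻¹ • x)
  have hφC : ∀ r, ContDiff ℝ 1 (φ r) := fun r => hbC.comp (contDiff_const_smul _)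
  have hφs : ∀ r, 0 < r → HasCompactSupport (φ r) := fun r hr =>
    b.hasCompactSupport.comp_smul (inv_ne_zero hr.ne')
  have hφ' : ∀ r, 0 < r → ∀ x i, |fderiv ℝ (φ r) x (EuclideanSpace.single i 1)| ≤ r⁻¹ * C := by
    intro r hr x i
    have h1 : HasFDerivAt (φ r) ((fderiv ℝ b (r⁻¹ • x)).comp
        (r⁻¹ • ContinuousLinearMap.id ℝ _)) x :=
      (hbC.differentiable (by simp) _).hasFDerivAt.comp x
        ((hasFDerivAt_id x).const_smul r⁻¹)
    rw [h1.fderiv]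
    have h2 := (fderiv ℝ b (r⁻¹ • x)).le_opNorm (EuclideanSpace.single i 1)
    simp only [PiLp.norm_single, norm_one, mul_one, Real.norm_eq_abs] at h2
    simp only [ContinuousLinearMap.comp_apply, _root_.smul_apply,
      ContinuousLinearMap.id_apply, map_smul, smul_eq_mul, abs_mul, abs_inv, abs_of_pos hr]
    exact mul_le_mul_of_nonneg_left (h2.trans (hC _)) (by positivity)
  have hint : ∀ r, 0 < r → ∫ x, φ r x * D x ≤ (n * C * ∫ x, B x) * r⁻¹ := by
    intro r hr
    have hi1 : ∀ i, Integrable fun x => φ r x * fderiv ℝ (G i) x (EuclideanSpace.single i 1) :=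
      fun i => ((hφC r).continuous.mul (hDi i)).integrable_of_hasCompactSupport (hφs r hr).mul_right
    have hsupp : ∀ i, HasCompactSupport
        fun x => fderiv ℝ (φ r) x (EuclideanSpace.single i 1) := fun i =>
      (hφs r hr).fderiv_apply (𝕜 := ℝ) _
    have hcont : ∀ i, Continuous fun x => fderiv ℝ (φ r) x (EuclideanSpace.single i 1) := fun i =>
      ((hφC r).continuous_fderiv (by simp)).clm_apply continuous_const
    have hi2 : ∀ i, Integrable fun x => fderiv ℝ (φ r) x (EuclideanSpace.single i 1) * G i x :=
      fun i => ((hcont i).mul (hG i).continuous).integrable_of_hasCompactSupport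
        (hsupp i).mul_right
    have hi3 : ∀ i, Integrable fun x => φ r x * G i x := fun i =>
      ((hφC r).continuous.mul (hG i).continuous).integrable_of_hasCompactSupport
        (hφs r hr).mul_right
    calc ∫ x, φ r x * D x
        = ∑ i, ∫ x, φ r x * fderiv ℝ (G i) x (EuclideanSpace.single i 1) := by
          rw [← integral_finsetSum _ fun i _ => hi1 i]
          simp only [D, Finset.mul_sum]
      _ = ∑ i, -∫ x, fderiv ℝ (φ r) x (EuclideanSpace.single i 1) * G i x :=
          Finset.sum_congr rfl fun i _ => integral_mul_fderiv_eq_neg_fderiv_mul_of_integrable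
            (hi2 i) (hi1 i) (hi3 i)
            (fun x _ => (hφC r).differentiable (by simp) x)
            (fun x _ => (hG i).differentiable (by simp) x)
      _ ≤ ∑ _i : Fin n, r⁻¹ * C * ∫ x, B x := by
          refine Finset.sum_le_sum fun i _ => ?_
          rw [← integral_neg, ← integral_const_mul]
          refine integral_mono (hi2 i).neg (hB.const_mul _) fun x => ?_
          refine (neg_le_abs _).trans ?_
          rw [abs_mul]
          exact mul_le_mul (hφ' r hr x i) (hGB i x) (abs_nonneg _) (by positivity)
      _ = (n * C * ∫ x, B x) * r⁻¹ := by simp; ring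
  by_contra hne
  let s : ℝ := ‖x₀‖ + 1
  have hs : 0 < s := by positivity
  have hpos : 0 < ∫ x, φ s x * D x := by
    refine ((hφC s).continuous.mul hD).integral_pos_of_hasCompactSupport_nonneg_nonzero (x := x₀)
      (hφs s hs).mul_right (fun x => mul_nonneg b.nonneg (hdiv x)) ?_
    refine mul_ne_zero ?_ hne
    have : φ s x₀ = 1 := b.one_of_mem_closedBall (by
      rw [mem_closedBall_zero_iff, norm_smul, norm_inv, Real.norm_of_nonneg hs.le,
        inv_mul_le_iff₀ hs]
      simp [b, s])
    rw [this]; exact one_ne_zero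
  -- the cutoff at scale `r ≥ 2 * s` is `1` on the support of the cutoff at scale `s`
  have hle : ∀ r, 2 * s ≤ r → ∫ x, φ s x * D x ≤ (n * C * ∫ x, B x) * r⁻¹ := by
    intro r hr
    have hr0 : 0 < r := by linarith
    refine le_trans (integral_mono ?_ ?_ fun x => ?_) (hint r hr0)
    · exact ((hφC s).continuous.mul hD).integrable_of_hasCompactSupport (hφs s hs).mul_right
    · exact ((hφC r).continuous.mul hD).integrable_of_hasCompactSupport (hφs r hr0).mul_right
    · refine mul_le_mul_of_nonneg_right ?_ (hdiv x)
      rcases le_or_gt (2 * s) ‖x‖ with hx | hx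
      · have : φ s x = 0 := b.zero_of_le_dist (by
          rw [dist_zero_right, norm_smul, norm_inv, Real.norm_of_nonneg hs.le,
            le_inv_mul_iff₀ hs]
          simpa [b, mul_comm] using hx)
        rw [this]; exact b.nonneg
      · have : φ r x = 1 := b.one_of_mem_closedBall (by
          rw [mem_closedBall_zero_iff, norm_smul, norm_inv, Real.norm_of_nonneg hr0.le,
            inv_mul_le_iff₀ hr0]
          simpa [b] using hx.le.trans hr)
        rw [this]; exact b.le_one
  have hlim : Filter.Tendsto (fun r : ℝ => (n * C * ∫ x, B x) * r⁻¹) Filter.atTop (nhds 0) := by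
    simpa using tendsto_inv_atTop_zero.const_mul (n * C * ∫ x, B x)
  exact absurd (ge_of_tendsto hlim (Filter.eventually_atTop.2 ⟨2 * s, hle⟩)) hpos.not_ge

noncomputable section

namespace GaussProduct

/-! ### The weighted minimal graph equation -/

theorem contDiff_of_contDiff_graphMap {n : ℕ} {u : Base n → ℝ} {k : WithTop ℕ∞}
    (h : ContDiff ℝ k (graphMap u)) : ContDiff ℝ k u := by
  have := (EuclideanSpace.proj (Fin.last n) : Ambient n →L[ℝ] ℝ).contDiff.comp h
  simpa [Function.comp_def, graphMap] using! this

theorem hasFDerivAt_graphMap {n : ℕ} {u : Base n → ℝ} (hu : Differentiable ℝ u) (x : Base n) :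
    HasFDerivAt (graphMap u)
      ((ptL n).comp ((ContinuousLinearMap.id ℝ (Base n)).prod (fderiv ℝ u x))) x :=
  (ptL n).hasFDerivAt.comp x ((hasFDerivAt_id x).prodMk (hu x).hasFDerivAt)

theorem fderiv_graphMap_apply {n : ℕ} {u : Base n → ℝ} (hu : Differentiable ℝ u) (x v : Base n) :
    fderiv ℝ (graphMap u) x v = pt v (fderiv ℝ u x v) := by
  rw [(hasFDerivAt_graphMap hu x).fderiv]; rfl

theorem fderiv_fderiv_graphMap_apply {n : ℕ} {u : Base n → ℝ} (hu : ContDiff ℝ 2 u)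
    (x v w : Base n) :
    fderiv ℝ (fderiv ℝ (graphMap u)) x v w = pt 0 (fderiv ℝ (fderiv ℝ u) x v w) := by
  have hu1 : Differentiable ℝ u := hu.differentiable (by simp)
  have hu2 : Differentiable ℝ (fderiv ℝ u) :=
    (hu.fderiv_right (m := 1) (by norm_num)).differentiable (by simp)
  have hX : ContDiff ℝ 2 (graphMap u) := (ptL n).contDiff.comp (contDiff_id.prodMk hu)
  have hX2 : DifferentiableAt ℝ (fderiv ℝ (graphMap u)) x :=
    (hX.fderiv_right (m := 1) (by norm_num)).differentiable (by simp) x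
  -- evaluate the first derivative on `w` before differentiating it in the direction `v`
  have h1 : HasFDerivAt (fun y => fderiv ℝ (graphMap u) y w)
      ((fderiv ℝ (fderiv ℝ (graphMap u)) x).flip w) x := by
    simpa using! hX2.hasFDerivAt.clm_apply (hasFDerivAt_const w x)
  have h2 : HasFDerivAt (fun y => fderiv ℝ u y w) ((fderiv ℝ (fderiv ℝ u) x).flip w) x := by
    simpa using! (hu2 x).hasFDerivAt.clm_apply (hasFDerivAt_const w x)
  have h3 : HasFDerivAt (fun y => fderiv ℝ (graphMap u) y w) ((ptL n).comp
      ((0 : Base n →L[ℝ] Base n).prod ((fderiv ℝ (fderiv ℝ u) x).flip w))) x := by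
    simp_rw [fderiv_graphMap_apply hu1]
    exact (ptL n).hasFDerivAt.comp x ((hasFDerivAt_const w x).prodMk h2)
  have := congrArg (fun L => L v) (h1.unique h3)
  simpa using this

theorem gradient_potential {n : ℕ} (z : Ambient n) :
    gradient potential z = pt (proj z) 0 := by
  have h : HasFDerivAt (potential (n := n)) ((2⁻¹ : ℝ) • (2 • (innerSL ℝ (proj z)).comp (projL n)))
      z := by
    have h1 := (((projL n).hasFDerivAt (x := z)).norm_sq.const_mul (2⁻¹ : ℝ)).add_const
      ((n : ℝ) / 2 * Real.log (2 * Real.pi))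
    refine h1.congr_of_eventuallyEq (.of_forall fun y => ?_)
    simp [potential, gaussPotential]; ring
  refine HasGradientAt.gradient ?_
  rw [hasGradientAt_iff_hasFDerivAt]
  refine h.congr_fderiv (ContinuousLinearMap.ext fun v => ?_)
  have hv : v = pt (proj v) (v (Fin.last n)) := by
    ext i; refine Fin.lastCases ?_ (fun i => ?_) i <;> simp [proj]
  rw [InnerProductSpace.toDual_apply_apply]
  conv_rhs => rw [hv, inner_pt_pt]
  simp

/-- The partial derivative `∂ᵢ u`. -/
def partialDeriv {n : ℕ} (u : Base n → ℝ) (i : Fin n) (x : Base n) : ℝ :=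
  fderiv ℝ u x (EuclideanSpace.single i 1)

/-- The entry `∂ᵢ ∂ⱼ u` of the Hessian. -/
def hessian {n : ℕ} (u : Base n → ℝ) (x : Base n) (i j : Fin n) : ℝ :=
  fderiv ℝ (fderiv ℝ u) x (EuclideanSpace.single i 1) (EuclideanSpace.single j 1)

/-- The squared area element `1 + |∇u|²` of the graph of `u`. -/
def areaSq {n : ℕ} (u : Base n → ℝ) (x : Base n) : ℝ := 1 + ∑ i, partialDeriv u i x ^ 2

theorem areaSq_pos {n : ℕ} (u : Base n → ℝ) (x : Base n) : 0 < areaSq u x := by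
  unfold areaSq; positivity

theorem fderiv_eq_sum_partialDeriv {n : ℕ} (u : Base n → ℝ) (x v : Base n) :
    fderiv ℝ u x v = ∑ i, v i * partialDeriv u i x := by
  conv_lhs => rw [← (EuclideanSpace.basisFun (Fin n) ℝ).sum_repr v]
  simp [partialDeriv]

/-- By the Sherman–Morrison formula, as the first fundamental form is `1 + ∇u ∇uᵀ`. -/
theorem inv_firstForm_graphMap {n : ℕ} {u : Base n → ℝ} (hu : Differentiable ℝ u) (x : Base n) :
    (firstForm (graphMap u) x)⁻¹ = 1 - (areaSq u x)⁻¹ •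
      Matrix.vecMulVec (partialDeriv u · x) (partialDeriv u · x) := by
  set p : Fin n → ℝ := (partialDeriv u · x) with hp
  have hI : firstForm (graphMap u) x = 1 + Matrix.vecMulVec p p := by
    ext i j
    simp only [firstForm, Matrix.of_apply, fderiv_graphMap_apply hu, inner_pt_pt,
      Matrix.add_apply, Matrix.vecMulVec_apply]
    congr 1
    simp [Matrix.one_apply, EuclideanSpace.inner_single_left]
  have hs : p ⬝ᵥ p = areaSq u x - 1 := by
    simp [areaSq, dotProduct, p, pow_two]
  have hne := (areaSq_pos u x).ne'
  refine Matrix.inv_eq_right_inv ?_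
  rw [hI, add_mul, one_mul, mul_sub, mul_one, Matrix.mul_smul, Matrix.vecMulVec_mul_vecMulVec, hs]
  ext i j
  simp only [Matrix.add_apply, Matrix.sub_apply, Matrix.smul_apply, Matrix.vecMulVec_apply,
    smul_eq_mul, Pi.smul_apply]
  field_simp
  ring

/-- The upward unit normal `(-∇u, 1) / √(1 + |∇u|²)` of the graph of `u`. -/
def upNormal {n : ℕ} (u : Base n → ℝ) (x : Base n) : Ambient n :=
  (√(areaSq u x))⁻¹ • pt (WithLp.toLp 2 fun i => -partialDeriv u i x) 1

theorem isUnitNormal_upNormal {n : ℕ} {u : Base n → ℝ} (hu : Differentiable ℝ u) (x : Base n) :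
    IsUnitNormal (graphMap u) x (upNormal u x) := by
  have hpos := areaSq_pos u x
  constructor
  · have h1 : ‖pt (WithLp.toLp 2 fun i => -partialDeriv u i x : Base n) 1‖ = √(areaSq u x) := by
      rw [EuclideanSpace.norm_eq, Fin.sum_univ_castSucc]
      simp [areaSq, add_comm]
    rw [upNormal, norm_smul, h1, norm_inv, Real.norm_of_nonneg (Real.sqrt_nonneg _)]
    exact inv_mul_cancel₀ (Real.sqrt_pos.2 hpos).ne'
  · intro v
    rw [fderiv_graphMap_apply hu, upNormal, inner_smul_right, inner_pt_pt,
      fderiv_eq_sum_partialDeriv]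
    simp [PiLp.inner_apply, mul_comm]

/-- The Euler–Lagrange equation of weighted minimal graphs, in nondivergence form. -/
theorem IsWeightedMinimal.graph_equation {n : ℕ} {u : Base n → ℝ}
    (hmin : IsWeightedMinimal (graphMap u)) (x : Base n) :
    ∑ i, hessian u x i i
      - (areaSq u x)⁻¹ * ∑ i, ∑ j, partialDeriv u i x * partialDeriv u j x * hessian u x i j
      - ∑ i, x i * partialDeriv u i x = 0 := by
  have hu : ContDiff ℝ 2 u := contDiff_of_contDiff_graphMap hmin.contDiff
  have hu1 : Differentiable ℝ u := hu.differentiable (by simp)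
  have hW : (√(areaSq u x))⁻¹ ≠ 0 := inv_ne_zero (Real.sqrt_pos.2 (areaSq_pos u x)).ne'
  have h := hmin.weightedMeanCurvature_eq_zero x _ (isUnitNormal_upNormal hu1 x)
  have hII : secondForm (graphMap u) x (upNormal u x)
      = (√(areaSq u x))⁻¹ • Matrix.of (hessian u x) := by
    ext i j
    simp [secondForm, fderiv_fderiv_graphMap_apply hu, upNormal, inner_smul_right, inner_pt_pt,
      hessian]
  have hg : ⟪gradient potential (graphMap u x), upNormal u x⟫_ℝ
      = (√(areaSq u x))⁻¹ * -∑ i, x i * partialDeriv u i x := by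
    rw [gradient_potential, upNormal, inner_smul_right, graphMap, proj_pt, inner_pt_pt]
    simp [PiLp.inner_apply, mul_comm]
  rw [weightedMeanCurvature, meanCurvature, inv_firstForm_graphMap hu1, hII, hg, Matrix.mul_smul,
    Matrix.trace_smul, smul_eq_mul, ← mul_add] at h
  have h' := (mul_eq_zero.1 h).resolve_left hW
  rw [sub_mul, one_mul, Matrix.smul_mul, Matrix.trace_sub, Matrix.trace_smul] at h'
  have ht : (Matrix.vecMulVec (partialDeriv u · x) (partialDeriv u · x)
      * Matrix.of (hessian u x)).trace
      = ∑ i, ∑ j, partialDeriv u i x * partialDeriv u j x * hessian u x i j := by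
    rw [Finset.sum_comm]
    simp only [Matrix.trace, Matrix.diag_apply, Matrix.mul_apply, Matrix.vecMulVec_apply,
      Matrix.of_apply]
    exact Finset.sum_congr rfl fun i _ => Finset.sum_congr rfl fun j _ => by ring
  rw [ht] at h'
  simpa [Matrix.trace, sub_eq_add_neg] using h'

end GaussProduct

end

noncomputable section

namespace GaussProduct

/-! ### Rigidity of entire weighted minimal graphs -/

theorem integrable_exp_neg_half_norm_sq (n : ℕ) :
    Integrable fun x : Base n => Real.exp (-(‖x‖ ^ 2 / 2)) := by
  have h := (GaussianFourier.integrable_cexp_neg_mul_sq_norm_add (V := Base n)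
    (b := ((1 / 2 : ℝ) : ℂ)) (by norm_num) 0 0).norm
  refine h.congr (.of_forall fun x => ?_)
  simp only [Complex.norm_exp]
  congr 1
  simp [← Complex.ofReal_pow]
  ring

/-- The components of the weighted gradient field `arctan u · e^{-|x|²/2} · ∇u / √(1 + |∇u|²)`. -/
def testField {n : ℕ} (u : Base n → ℝ) (i : Fin n) (x : Base n) : ℝ :=
  Real.arctan (u x) * (Real.exp (-(‖x‖ ^ 2 / 2)) * (partialDeriv u i x * (√(areaSq u x))⁻¹))

theorem hasFDerivAt_partialDeriv {n : ℕ} {u : Base n → ℝ} (hu : ContDiff ℝ 2 u) (i : Fin n)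
    (x : Base n) : HasFDerivAt (partialDeriv u i)
      ((fderiv ℝ (fderiv ℝ u) x).flip (EuclideanSpace.single i 1)) x := by
  have hu2 : DifferentiableAt ℝ (fderiv ℝ u) x :=
    (hu.fderiv_right (m := 1) (by norm_num)).differentiable (by simp) x
  simpa using! hu2.hasFDerivAt.clm_apply (hasFDerivAt_const (EuclideanSpace.single i (1 : ℝ)) x)

theorem contDiff_partialDeriv {n : ℕ} {u : Base n → ℝ} (hu : ContDiff ℝ 2 u) (i : Fin n) :
    ContDiff ℝ 1 (partialDeriv u i) :=
  (hu.fderiv_right (m := 1) (by norm_num)).clm_apply contDiff_const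

theorem contDiff_testField {n : ℕ} {u : Base n → ℝ} (hu : ContDiff ℝ 2 u) (i : Fin n) :
    ContDiff ℝ 1 (testField u i) := by
  have h0 : ContDiff ℝ 1 u := hu.of_le (by norm_num)
  have h1 : ContDiff ℝ 1 (areaSq u) :=
    contDiff_const.add (ContDiff.sum fun j _ => (contDiff_partialDeriv hu j).pow 2)
  have h2 : ContDiff ℝ 1 fun x => (√(areaSq u x))⁻¹ :=
    (h1.sqrt fun x => (areaSq_pos u x).ne').inv fun x => (Real.sqrt_pos.2 (areaSq_pos u x)).ne'
  have h3 : ContDiff ℝ 1 fun x : Base n => Real.exp (-(‖x‖ ^ 2 / 2)) :=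
    ((contDiff_norm_sq ℝ).div_const 2).neg.exp
  exact (Real.contDiff_arctan.comp h0).mul (h3.mul ((contDiff_partialDeriv hu i).mul h2))

theorem abs_testField_le {n : ℕ} (u : Base n → ℝ) (i : Fin n) (x : Base n) :
    |testField u i x| ≤ Real.pi / 2 * Real.exp (-(‖x‖ ^ 2 / 2)) := by
  have h1 : |Real.arctan (u x)| ≤ Real.pi / 2 :=
    abs_le.2 ⟨(Real.neg_pi_div_two_lt_arctan _).le, (Real.arctan_lt_pi_div_two _).le⟩
  have h2 : |partialDeriv u i x * (√(areaSq u x))⁻¹| ≤ 1 := by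
    rw [abs_mul, abs_inv, abs_of_nonneg (Real.sqrt_nonneg _), ← div_eq_mul_inv,
      div_le_one (Real.sqrt_pos.2 (areaSq_pos u x))]
    refine Real.abs_le_sqrt ?_
    have := Finset.single_le_sum (f := fun j => partialDeriv u j x ^ 2)
      (fun j _ => sq_nonneg _) (Finset.mem_univ i)
    simp only [areaSq]; linarith
  rw [testField, abs_mul, abs_mul, Real.abs_exp]
  refine mul_le_mul h1 (mul_le_of_le_one_right (Real.exp_nonneg _) h2) (by positivity)
    (by positivity)

theorem fderiv_testField_single {n : ℕ} {u : Base n → ℝ} (hu : ContDiff ℝ 2 u) (i : Fin n)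
    (x : Base n) :
    fderiv ℝ (testField u i) x (EuclideanSpace.single i 1)
      = Real.exp (-(‖x‖ ^ 2 / 2)) * (√(areaSq u x))⁻¹ *
        ((1 + u x ^ 2)⁻¹ * partialDeriv u i x ^ 2 + Real.arctan (u x) * (hessian u x i i
          - (areaSq u x)⁻¹ * ∑ j, partialDeriv u i x * partialDeriv u j x * hessian u x i j
          - x i * partialDeriv u i x)) := by
  have hpos := areaSq_pos u x
  have hsq : √(areaSq u x) ^ 2 = areaSq u x := Real.sq_sqrt hpos.le
  have hW : √(areaSq u x) ≠ 0 := (Real.sqrt_pos.2 hpos).ne'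
  have hu1 : HasFDerivAt u (fderiv ℝ u x) x := (hu.differentiable (by simp) x).hasFDerivAt
  have hA : HasFDerivAt (areaSq u) (∑ j, (2 * partialDeriv u j x) •
      (fderiv ℝ (fderiv ℝ u) x).flip (EuclideanSpace.single j 1)) x := by
    refine (HasFDerivAt.fun_sum fun j _ => ?_).const_add 1
    simpa using (hasFDerivAt_partialDeriv hu j x).pow 2
  have hI := (hasDerivAt_inv hW).comp_hasFDerivAt x (hA.sqrt hpos.ne')
  have hE := (((hasFDerivAt_id x).norm_sq.mul_const (2⁻¹ : ℝ)).neg).exp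
  have hT := hu1.arctan.mul (hE.mul ((hasFDerivAt_partialDeriv hu i x).mul hI))
  have hT' : HasFDerivAt (testField u i) _ x := hT
  have hx : ⟪x, EuclideanSpace.single i 1⟫_ℝ = x i := by
    simp [EuclideanSpace.inner_single_right]
  have hs1 : ∑ j, 2 * partialDeriv u j x * hessian u x i j
      = 2 * ∑ j, partialDeriv u j x * hessian u x i j := by
    simp only [Finset.mul_sum, mul_assoc]
  have hs2 : ∑ j, partialDeriv u i x * partialDeriv u j x * hessian u x i j
      = partialDeriv u i x * ∑ j, partialDeriv u j x * hessian u x i j := by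
    simp only [Finset.mul_sum, mul_assoc]
  have hp : fderiv ℝ u x (EuclideanSpace.single i 1) = partialDeriv u i x := rfl
  have hH : ∀ j, fderiv ℝ (fderiv ℝ u) x (EuclideanSpace.single i 1) (EuclideanSpace.single j 1)
      = hessian u x i j := fun _ => rfl
  rw [hT'.fderiv]
  simp [hx, hp, hH, hs1, hs2, hsq, div_eq_mul_inv]
  ring

/-- The Bernstein property. As `e^{-|x|²/2} ∇u / √(1 + |∇u|²)` is divergence free, the divergence of
its product with `arctan u` is `e^{-|x|²/2} |∇u|² / ((1 + u²) √(1 + |∇u|²)) ≥ 0`, while the product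
is bounded by a multiple of the Gaussian density. -/
theorem IsWeightedMinimal.partialDeriv_eq_zero {n : ℕ} {u : Base n → ℝ}
    (hmin : IsWeightedMinimal (graphMap u)) (i : Fin n) (x : Base n) : partialDeriv u i x = 0 := by
  have hu : ContDiff ℝ 2 u := contDiff_of_contDiff_graphMap hmin.contDiff
  have hdiv : ∀ x, ∑ i, fderiv ℝ (testField u i) x (EuclideanSpace.single i 1)
      = Real.exp (-(‖x‖ ^ 2 / 2)) * (√(areaSq u x))⁻¹ *
        ((1 + u x ^ 2)⁻¹ * ∑ i, partialDeriv u i x ^ 2) := by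
    intro x
    simp only [fderiv_testField_single hu]
    rw [← Finset.mul_sum, Finset.sum_add_distrib, ← Finset.mul_sum, ← Finset.mul_sum,
      Finset.sum_sub_distrib, Finset.sum_sub_distrib, ← Finset.mul_sum, hmin.graph_equation x,
      mul_zero, add_zero]
  have h0 := sum_fderiv_eq_zero_of_nonneg_of_integrable_bound (contDiff_testField hu)
    ((integrable_exp_neg_half_norm_sq n).const_mul (Real.pi / 2)) (abs_testField_le u)
    (fun x => by rw [hdiv]; positivity) x
  rw [hdiv] at h0
  have hW : (√(areaSq u x))⁻¹ ≠ 0 := inv_ne_zero (Real.sqrt_pos.2 (areaSq_pos u x)).ne'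
  have h1 : (1 + u x ^ 2)⁻¹ ≠ 0 := by positivity
  have h2 : ∑ i, partialDeriv u i x ^ 2 = 0 := by
    simpa [hW, h1, Real.exp_ne_zero] using h0
  exact pow_eq_zero_iff two_ne_zero |>.1
    ((Finset.sum_eq_zero_iff_of_nonneg fun j _ => sq_nonneg _).1 h2 i (Finset.mem_univ i))

theorem IsWeightedMinimal.eq_const {n : ℕ} {u : Base n → ℝ}
    (hmin : IsWeightedMinimal (graphMap u)) : u = fun _ => u 0 := by
  have hu : Differentiable ℝ u :=
    (contDiff_of_contDiff_graphMap hmin.contDiff).differentiable (by simp)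
  funext x
  refine is_const_of_fderiv_eq_zero hu (fun y => ?_) x 0
  ext v
  simp [fderiv_eq_sum_partialDeriv, hmin.partialDeriv_eq_zero]

end GaussProduct

end

theorem mainTheorem2 (n : ℕ) (hn : 1 ≤ n) (u : GaussProduct.Base n → ℝ)
    (hmin : GaussProduct.IsWeightedMinimal (GaussProduct.graphMap u))
    (p : GaussProduct.Ambient n) (hp : p ∈ GaussProduct.graph u) (hp_axis : GaussProduct.proj p = 0)
    (R : ℝ) (hR : 0 < R) :
    GaussProduct.weightedArea (GaussProduct.graph u ∩ Metric.ball p R)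
      ≤ GaussProduct.gaussVol (Metric.ball (0 : GaussProduct.Base n) R)
        + ENNReal.ofReal (n * Real.exp (-R ^ 2)
            * (MeasureTheory.volume (Metric.ball (0 : GaussProduct.Base n) 1)).toReal
            * R ^ (n - 1)) := by
  have hu := hmin.eq_const
  obtain ⟨x, rfl⟩ := hp
  obtain rfl : x = 0 := by simpa [GaussProduct.graphMap] using hp_axis
  have hp0 : GaussProduct.graphMap u 0 = GaussProduct.pt 0 (u 0) := rfl
  rw [hp0, hu]
  exact (GaussProduct.weightedArea_graph_const_inter_ball (u 0) R).le.trans le_self_add
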